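/- Let $n, k, d$ be positive integers with $k > d \ge 2$ and $n \ge 2k+2d-3$, and let $\mathcal{F}$ be an intersecting family of $k$-element subsets of $[n]=\{1,\dots,n\}$, i.e. $A\cap B\neq\emptyset$ for all $A,B\in\mathcal{F}$. For $S\subseteq[n]$ let $d_S(\mathcal{F})=|\{T\in\mathcal{F}: S\subseteq T\}|$, and let $\delta_d(\mathcal{F})=\min\{d_S(\mathcal{F}): S\subseteq[n],\ |S|=d\}$ be the minimum $d$-degree of $\mathcal{F}$. Then $$\delta_d(\mathcal{F})\le\binom{n-d-1}{k-d-1}.$$ That is, some $d$-element subset of $[n]$ is contained in at most $\binom{n-d-1}{k-d-1}$ members of $\mathcal{F}$. In particular, for $d=2$ the bound holds for all $n\ge 2k+1$. -/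

import Mathlib

/-- The `S`-degree of a family `F` of subsets of an `n`-element set: the number of members of `F`
that contain `S`. -/
def setDegree {n : ℕ} (F : Finset (Finset (Fin n))) (S : Finset (Fin n)) : ℕ :=
  (F.filter (fun T => S ⊆ T)).card

/-- The minimum `d`-degree of `F`: the minimum of the `S`-degrees over all `S` of size `d`
(such `S` exist whenever `d ≤ n`, see `isLeast_minDegree`). -/
noncomputable def minDegree {n : ℕ} (d : ℕ) (F : Finset (Finset (Fin n))) : ℕ :=
  sInf {m : ℕ | ∃ S : Finset (Fin n), S.card = d ∧ setDegree F S = m}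

/-- For `d ≤ n` the minimum in the definition of `minDegree` is a genuine, attained minimum. -/
theorem isLeast_minDegree {n d : ℕ} (hdn : d ≤ n) (F : Finset (Finset (Fin n))) :
    IsLeast {m : ℕ | ∃ S : Finset (Fin n), S.card = d ∧ setDegree F S = m} (minDegree d F) := by
  have hne : {m : ℕ | ∃ S : Finset (Fin n), S.card = d ∧ setDegree F S = m}.Nonempty := by
    obtain ⟨S, -, hS⟩ := Finset.exists_subset_card_eq
      (s := (Finset.univ : Finset (Fin n))) (n := d) (by simpa using hdn)
    exact ⟨_, S, hS, rfl⟩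
  exact ⟨Nat.sInf_mem hne, fun m hm => Nat.sInf_le hm⟩

/-! The argument is a Hoffman-type bound. Let `f` be the indicator of the family, `K` the Kneser
operator and `Ω` the operator summing `d`-degrees over the `d`-sets disjoint from `T`. For `T` in
the family, `Kf(T) = 0` by intersection, while `Ωf(T)` is at least `(n-k).choose d` times the
minimum degree. So if every eigenvalue of `Ω - cK` is at most `τ = (n-d-1).choose (k-d-1) *
(n-k).choose d`, comparing quadratic forms at `f` gives the theorem.

`Ω` and `K` act as scalars on the harmonic levels of the Johnson scheme
(`IsHarmonic.degreeKneser_levelSum`), which are mutually orthogonal and span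
(`exists_harmonic_decomposition`). The constant `c` makes levels 0 and 1, where stars live, both
have eigenvalue exactly `τ`. That the other levels stay below `τ` is `alternating_sub_le`; only
there is the full bound `n ≥ 2k+2d-3` needed. -/

open Finset in
/-- The sum of `h` over the `i`-element subsets of `T`. -/
def levelSum {α : Type*} (i : ℕ) (h : Finset α → ℝ) (T : Finset α) : ℝ :=
  ∑ I ∈ T.powersetCard i, h I

open Finset in
/-- The sum of `h` over the `i`-element supersets of `J`. -/
def supersetSum {α : Type*} [Fintype α] [DecidableEq α] (i : ℕ) (h : Finset α → ℝ)
    (J : Finset α) : ℝ :=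
  ∑ I ∈ (univ : Finset α).powersetCard i with J ⊆ I, h I

open Finset in
/-- `h` is annihilated, on the `i`-element sets, by the lowering operator. -/
def IsHarmonic {α : Type*} [Fintype α] [DecidableEq α] (i : ℕ) (h : Finset α → ℝ) : Prop :=
  ∀ J : Finset α, J.card + 1 = i → ∑ x ∈ Jᶜ, h (insert x J) = 0

/-! ### Harmonic levels of functions on `k`-sets -/

section Levels

open Finset

variable {α : Type*} [Fintype α] [DecidableEq α]

theorem mul_supersetSum (i : ℕ) (h : Finset α → ℝ) (J : Finset α) :
    ((i : ℝ) - J.card) * supersetSum i h J = ∑ x ∈ Jᶜ, supersetSum i h (insert x J) := by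
  have key : ∑ x ∈ Jᶜ, supersetSum i h (insert x J)
      = ∑ I ∈ (univ : Finset α).powersetCard i with J ⊆ I, ∑ x ∈ I \ J, h I := by
    unfold supersetSum
    apply Finset.sum_comm'
    intro x I
    simp only [mem_compl, mem_filter, mem_powersetCard, subset_univ, true_and, mem_sdiff,
      insert_subset_iff]
    tauto
  rw [key, supersetSum, Finset.mul_sum]
  refine Finset.sum_congr rfl fun I hI => ?_
  simp only [mem_filter, mem_powersetCard, subset_univ, true_and] at hI
  rw [Finset.sum_const, card_sdiff_of_subset hI.2, nsmul_eq_mul, hI.1,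
    Nat.cast_sub (hI.1 ▸ card_le_card hI.2)]

theorem supersetSum_card_self (h : Finset α → ℝ) (J : Finset α) :
    supersetSum J.card h J = h J := by
  have : ((univ : Finset α).powersetCard J.card).filter (J ⊆ ·) = {J} := by
    ext I
    simp only [mem_filter, mem_powersetCard, subset_univ, true_and, mem_singleton]
    constructor
    · rintro ⟨h1, h2⟩
      exact (eq_of_subset_of_card_le h2 h1.le).symm
    · rintro rfl
      simp
  rw [supersetSum, this, sum_singleton]

/-- Descending induction on the size of `J`: harmonicity is the case `i - 1`, and `mul_supersetSum`
passes from the sets `insert x J` to `J`. -/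
theorem IsHarmonic.supersetSum_eq_zero {i : ℕ} {h : Finset α → ℝ} (hh : IsHarmonic i h)
    (J : Finset α) (hJ : J.card < i) : supersetSum i h J = 0 := by
  obtain ⟨m, hm⟩ : ∃ m, i = J.card + 1 + m := Nat.exists_eq_add_of_le hJ
  induction m generalizing J with
  | zero =>
    have h1 := mul_supersetSum i h J
    have h2 : ∑ x ∈ Jᶜ, supersetSum i h (insert x J) = 0 := by
      rw [← hh J hm.symm]
      refine Finset.sum_congr rfl fun x hx => ?_
      have hc : (insert x J).card = i := by
        rw [card_insert_of_notMem (by simpa using hx)]; exact hm.symm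
      conv_lhs => rw [← hc]
      exact supersetSum_card_self h _
    rw [h2, hm] at h1
    push_cast at h1
    rw [hm]
    linarith
  | succ m ih =>
    have h1 := mul_supersetSum i h J
    have h2 : ∑ x ∈ Jᶜ, supersetSum i h (insert x J) = 0 := by
      refine Finset.sum_eq_zero fun x hx => ?_
      have hc : (insert x J).card = J.card + 1 := card_insert_of_notMem (by simpa using hx)
      exact ih _ (by omega) (by omega)
    rw [h2] at h1
    rcases mul_eq_zero.1 h1 with h3 | h3
    · exfalso
      have : (J.card : ℝ) < i := by exact_mod_cast hJ
      linarith
    · exact h3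

/-- Inclusion-exclusion: a harmonic function sums over a set and over its complement to the same
value up to sign. -/
theorem IsHarmonic.levelSum_compl {i : ℕ} {h : Finset α → ℝ} (hh : IsHarmonic i h)
    (T : Finset α) : levelSum i h Tᶜ = (-1) ^ i * levelSum i h T := by
  have e1 : levelSum i h Tᶜ = ∑ I ∈ (univ : Finset α).powersetCard i,
      ∑ J ∈ (T ∩ I).powerset, (-1 : ℝ) ^ J.card * h I := by
    have : ∀ I : Finset α, ∑ J ∈ (T ∩ I).powerset, (-1 : ℝ) ^ J.card * h I
        = if I ⊆ Tᶜ then h I else 0 := by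
      intro I
      rw [← Finset.sum_mul]
      have := Finset.sum_powerset_neg_one_pow_card (x := T ∩ I)
      have h2 : ∑ J ∈ (T ∩ I).powerset, (-1 : ℝ) ^ J.card = if T ∩ I = ∅ then 1 else 0 := by
        exact_mod_cast congrArg (Int.cast : ℤ → ℝ) this
      rw [h2]
      have h3 : T ∩ I = ∅ ↔ I ⊆ Tᶜ := by
        rw [← disjoint_iff_inter_eq_empty, subset_compl_iff_disjoint_left]
      simp [h3]
    simp_rw [this]
    rw [← Finset.sum_filter, levelSum]
    refine Finset.sum_congr ?_ fun _ _ => rfl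
    ext I
    simp [mem_powersetCard, and_comm]
  have e2 : ∑ I ∈ (univ : Finset α).powersetCard i,
      ∑ J ∈ (T ∩ I).powerset, (-1 : ℝ) ^ J.card * h I
      = ∑ J ∈ T.powerset, (-1 : ℝ) ^ J.card * supersetSum i h J := by
    simp_rw [supersetSum, Finset.mul_sum]
    apply Finset.sum_comm'
    intro I J
    simp only [mem_powersetCard, mem_powerset, subset_inter_iff, mem_filter]
    tauto
  rw [e1, e2, levelSum, Finset.mul_sum]
  symm
  have hsub : T.powersetCard i ⊆ T.powerset := fun J hJ => mem_powerset.2 (mem_powersetCard.1 hJ).1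
  -- Only `J` of size `i` contribute: smaller ones vanish by harmonicity, larger ones lie in no
  -- `i`-set.
  rw [← Finset.sum_subset hsub]
  · refine Finset.sum_congr rfl fun J hJ => ?_
    obtain ⟨-, rfl⟩ := mem_powersetCard.1 hJ
    rw [supersetSum_card_self]
  · intro J hJ hJ'
    rcases lt_trichotomy J.card i with hlt | heq | hgt
    · rw [hh.supersetSum_eq_zero J hlt, mul_zero]
    · exact absurd (mem_powersetCard.2 ⟨mem_powerset.1 hJ, heq⟩) hJ'
    · rw [supersetSum, Finset.sum_eq_zero, mul_zero]
      intro I hI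
      simp only [mem_filter, mem_powersetCard, subset_univ, true_and] at hI
      have := card_le_card hI.2
      omega

theorem card_filter_subset_powersetCard {A I : Finset α} (hIA : I ⊆ A) {k : ℕ}
    (hk : I.card ≤ k) :
    ((A.powersetCard k).filter (I ⊆ ·)).card = (A.card - I.card).choose (k - I.card) := by
  rw [← card_sdiff_of_subset hIA, ← card_powersetCard]
  refine Finset.card_bij' (fun R _ => R \ I) (fun R _ => R ∪ I) ?_ ?_ ?_ ?_
  · intro R hR
    simp only [mem_filter, mem_powersetCard] at hR ⊢
    exact ⟨sdiff_subset_sdiff hR.1.1 subset_rfl, by rw [card_sdiff_of_subset hR.2, hR.1.2]⟩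
  · intro R hR
    simp only [mem_filter, mem_powersetCard, subset_sdiff] at hR ⊢
    refine ⟨⟨union_subset hR.1.1 hIA, ?_⟩, subset_union_right⟩
    rw [card_union_of_disjoint hR.1.2, hR.2]
    omega
  · intro R hR
    simp only [mem_filter] at hR
    exact sdiff_union_of_subset hR.2
  · intro R hR
    simp only [mem_powersetCard, subset_sdiff] at hR
    exact union_sdiff_cancel_right hR.1.2

theorem levelSum_levelSum {i k : ℕ} (hik : i ≤ k) (h : Finset α → ℝ) (A : Finset α) :
    levelSum k (levelSum i h) A = ((A.card - i).choose (k - i) : ℝ) * levelSum i h A := by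
  have e : levelSum k (levelSum i h) A
      = ∑ I ∈ A.powersetCard i, ∑ R ∈ (A.powersetCard k).filter (I ⊆ ·), h I := by
    unfold levelSum
    apply Finset.sum_comm'
    intro R I
    simp only [mem_powersetCard, mem_filter]
    constructor
    · rintro ⟨⟨h1, h2⟩, h3, h4⟩
      exact ⟨⟨⟨h1, h2⟩, h3⟩, h3.trans h1, h4⟩
    · rintro ⟨⟨⟨h1, h2⟩, h3⟩, h4, h5⟩
      exact ⟨⟨h1, h2⟩, h3, h5⟩
  rw [e, levelSum, Finset.mul_sum]
  refine Finset.sum_congr rfl fun I hI => ?_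
  obtain ⟨hIA, rfl⟩ := mem_powersetCard.1 hI
  rw [Finset.sum_const, card_filter_subset_powersetCard hIA hik, nsmul_eq_mul]

theorem supersetSum_eq_levelSum_compl {k : ℕ} (hk : k ≤ Fintype.card α) (g : Finset α → ℝ)
    (S : Finset α) :
    supersetSum k g S = levelSum (Fintype.card α - k) (fun R => g Rᶜ) Sᶜ := by
  unfold supersetSum levelSum
  refine Finset.sum_bij' (fun R _ => Rᶜ) (fun R _ => Rᶜ) ?_ ?_ ?_ ?_ ?_
  · intro R hR
    simp only [mem_filter, mem_powersetCard, subset_univ, true_and] at hR ⊢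
    exact ⟨compl_subset_compl.2 hR.2, by rw [card_compl, hR.1]⟩
  · intro R hR
    simp only [mem_filter, mem_powersetCard, subset_univ, true_and] at hR ⊢
    refine ⟨by rw [card_compl, hR.2]; omega, ?_⟩
    rw [← compl_compl S]
    exact compl_subset_compl.2 hR.1
  all_goals simp

/-- Complementation turns supersets of `S` into subsets of `Sᶜ`. `levelSum_compl` is then used
twice, and the two signs cancel. -/
theorem IsHarmonic.supersetSum_levelSum {i k : ℕ} {h : Finset α → ℝ} (hh : IsHarmonic i h)
    (hk : i + k ≤ Fintype.card α) (S : Finset α) :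
    supersetSum k (levelSum i h) S
      = ((Fintype.card α - S.card - i).choose (Fintype.card α - k - i) : ℝ) * levelSum i h S := by
  rw [supersetSum_eq_levelSum_compl (by omega)]
  have : (fun R : Finset α => levelSum i h Rᶜ) = fun R => (-1) ^ i * levelSum i h R :=
    funext hh.levelSum_compl
  rw [this]
  have e : levelSum (Fintype.card α - k) (fun R => (-1) ^ i * levelSum i h R) Sᶜ
      = (-1) ^ i * levelSum (Fintype.card α - k) (levelSum i h) Sᶜ := by
    simp [levelSum, Finset.mul_sum]
  rw [e, levelSum_levelSum (by omega), hh.levelSum_compl, card_compl]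
  have : ((-1 : ℝ) ^ i) * (-1) ^ i = 1 := by rw [← mul_pow]; simp
  linear_combination ((Fintype.card α - S.card - i).choose (Fintype.card α - k - i) : ℝ)
    * levelSum i h S * this

theorem sum_levelSum_mul (i k : ℕ) (h g : Finset α → ℝ) :
    ∑ T ∈ (univ : Finset α).powersetCard k, levelSum i h T * g T
      = ∑ I ∈ (univ : Finset α).powersetCard i, h I * supersetSum k g I := by
  simp_rw [levelSum, supersetSum, Finset.sum_mul, Finset.mul_sum]
  apply Finset.sum_comm'
  intro T I
  simp only [mem_powersetCard, mem_filter, subset_univ, true_and]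
  tauto

/-- By adjointness the sum moves to `i`-sets, where the second factor becomes a multiple of a sum
over `j`-subsets of an `i`-set, which is empty. -/
theorem sum_levelSum_mul_levelSum_of_lt {i j k : ℕ} (hij : i < j) {h h' : Finset α → ℝ}
    (hh' : IsHarmonic j h') (hk : j + k ≤ Fintype.card α) :
    ∑ T ∈ (univ : Finset α).powersetCard k, levelSum i h T * levelSum j h' T = 0 := by
  rw [sum_levelSum_mul]
  refine Finset.sum_eq_zero fun I hI => ?_
  obtain ⟨-, rfl⟩ := mem_powersetCard.1 hI
  rw [hh'.supersetSum_levelSum hk, levelSum, powersetCard_eq_empty.2 hij]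
  simp

/-- Every function is the sum of a harmonic one and one in the range of the raising operator. -/
theorem exists_harmonic_add (f : Finset α → ℝ) : ∃ h g : Finset α → ℝ,
    (∀ i, IsHarmonic i h) ∧ ∀ T, f T = h T + ∑ x ∈ T, g (T.erase x) := by
  let U : EuclideanSpace ℝ (Finset α) →ₗ[ℝ] EuclideanSpace ℝ (Finset α) :=
    { toFun := fun g => WithLp.toLp 2 fun T => ∑ x ∈ T, g (T.erase x)
      map_add' := by
        intro a b; ext T; simp [Finset.sum_add_distrib]
      map_smul' := by
        intro c a; ext T; simp [Finset.mul_sum] }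
  obtain ⟨y, hy, z, hz, hyz⟩ :=
    (LinearMap.range U).exists_add_mem_mem_orthogonal (WithLp.toLp 2 f)
  obtain ⟨g, rfl⟩ := hy
  refine ⟨z, g, ?_, ?_⟩
  · intro i J _
    -- Orthogonality to the range means being killed by the adjoint, the lowering operator; point
    -- masses as test functions show this.
    have h0 := hz (U (EuclideanSpace.single J 1)) ⟨_, rfl⟩
    rw [PiLp.inner_apply] at h0
    have h1 : ∀ T : Finset α, inner ℝ ((U (EuclideanSpace.single J (1 : ℝ))) T) (z T)
        = ∑ x ∈ T, if T.erase x = J then z T else 0 := by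
      intro T
      have : (U (EuclideanSpace.single J (1 : ℝ))) T
          = ∑ x ∈ T, if T.erase x = J then (1 : ℝ) else 0 := by
        simp [U]
      rw [this, real_inner_comm, real_inner_eq_re_inner, RCLike.inner_apply]
      simp only [conj_trivial, RCLike.re_to_real, Finset.sum_mul, ite_mul, one_mul, zero_mul]
    rw [Finset.sum_congr rfl fun T _ => h1 T] at h0
    rw [← h0]
    simp_rw [← Finset.sum_filter]
    rw [Finset.sum_sigma']
    refine Finset.sum_bij' (fun x _ => ⟨insert x J, x⟩) (fun p _ => p.2) ?_ ?_ ?_ ?_ ?_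
    · intro x hx
      simp only [mem_compl] at hx
      simp [hx]
    · rintro ⟨T, x⟩ hx
      simp only [mem_sigma, mem_univ, true_and, mem_filter] at hx
      simp [← hx.2]
    · simp
    · rintro ⟨T, x⟩ hx
      simp only [mem_sigma, mem_univ, true_and, mem_filter] at hx
      simp [← hx.2, insert_erase hx.1]
    · simp
  · intro T
    have := congrArg (fun v : EuclideanSpace ℝ (Finset α) => v T) hyz
    simp only [U] at this
    simpa [add_comm] using this

/-- The decomposition of a function on `k`-element sets into harmonic levels. -/
theorem exists_harmonic_decomposition (k : ℕ) (f : Finset α → ℝ) :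
    ∃ h : ℕ → Finset α → ℝ, (∀ i, IsHarmonic i (h i)) ∧
      ∀ T : Finset α, T.card = k → f T = ∑ i ∈ range (k + 1), levelSum i (h i) T := by
  induction k generalizing f with
  | zero =>
    refine ⟨fun _ T => if T = ∅ then f ∅ else 0, ?_, ?_⟩
    · intro i J _
      simp
    · intro T hT
      obtain rfl := card_eq_zero.1 hT
      simp [levelSum]
  | succ k ih =>
    obtain ⟨h₀, g, hh₀, hf⟩ := exists_harmonic_add f
    obtain ⟨h, hh, hg⟩ := ih g
    -- An `i`-set `I ⊆ T` survives the deletion of each of the `k + 1 - i` points of `T \ I`, whence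
    -- the factor.
    refine ⟨fun i => if i = k + 1 then h₀ else fun I => ((k + 1 : ℝ) - i) * h i I, ?_, ?_⟩
    · intro i
      by_cases hi : i = k + 1
      · simpa [hi] using hh₀ (k + 1)
      · intro J hJ
        simp only [hi, if_false]
        rw [← Finset.mul_sum, hh i J hJ, mul_zero]
    · intro T hT
      rw [Finset.sum_range_succ, hf T, add_comm]
      congr 1
      · have e : ∀ x ∈ T, g (T.erase x) = ∑ i ∈ range (k + 1), levelSum i (h i) (T.erase x) := by
          intro x hx
          exact hg _ (by rw [card_erase_of_mem hx, hT]; rfl)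
        rw [Finset.sum_congr rfl e, Finset.sum_comm]
        refine Finset.sum_congr rfl fun i hi => ?_
        have hi' : i < k + 1 := Finset.mem_range.1 hi
        simp only [hi'.ne, if_false]
        have e2 : ∑ x ∈ T, levelSum i (h i) (T.erase x)
            = ∑ I ∈ T.powersetCard i, ∑ x ∈ T \ I, h i I := by
          unfold levelSum
          apply Finset.sum_comm'
          intro x I
          simp only [mem_powersetCard, mem_sdiff, subset_erase]
          tauto
        rw [e2]
        unfold levelSum
        refine Finset.sum_congr rfl fun I hI => ?_
        obtain ⟨h1, h2⟩ := mem_powersetCard.1 hI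
        rw [Finset.sum_const, card_sdiff_of_subset h1, h2, hT, nsmul_eq_mul,
          Nat.cast_sub hi'.le]
        push_cast
        ring
      · simp [levelSum, ← hT]

/-- The operator `f ↦ Ωf - c Kf` on functions on `k`-element sets, where `K` is the Kneser operator
and `Ωf (T)` sums the `S`-degrees of `f` over the `d`-element sets `S` disjoint from `T`. -/
def degreeKneser (k d : ℕ) (c : ℝ) (f : Finset α → ℝ) (T : Finset α) : ℝ :=
  levelSum d (supersetSum k f) Tᶜ - c * levelSum k f Tᶜ

end Levels

/-! ### Estimates for the eigenvalue sequences -/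

section Spectrum

theorem mul_sub_mul_le_of_two_mul_add_le {n k d : ℕ} (hd : 2 ≤ d) (hdk : d < k)
    (hn : 2 * k + 2 * d ≤ n + 3) :
    (d : ℝ) * (n - 2 * d) * ((n - k - 1) * (n - k - 2))
      ≤ k * (n - 2 * k) * ((n - d - 1) * (n - d - 2)) := by
  obtain ⟨y, rfl⟩ := Nat.exists_eq_add_of_le hd
  obtain ⟨x, rfl⟩ := Nat.exists_eq_add_of_lt hdk
  obtain ⟨z, rfl⟩ : ∃ z, n = 4 * y + 7 + 2 * x + z :=
    Nat.exists_eq_add_of_le (by omega)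
  -- With the slack variables `x`, `y`, `z`, the expanded difference has only nonnegative
  -- coefficients.
  rw [← sub_nonneg]
  push_cast
  ring_nf
  positivity

/-- If `P` and `R` start proportionally to `k` and `d` and decrease by the factors
`(k - i) / (n - k - i)` and `(d - i) / (n - d - i)`, then `P i - R i` is at most its value at
`i = 1` for odd `i`, and nonnegative for every `i`. -/
theorem alternating_sub_le {n k d : ℕ} (hd : 2 ≤ d) (hdk : d < k)
    (hn : 2 * k + 2 * d ≤ n + 3) {P R : ℕ → ℝ} {w : ℝ} (hw : 0 ≤ w)
    (hP1 : P 1 = k * w) (hR1 : R 1 = d * w) (hR : ∀ i, d < i → R i = 0)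
    (hPs : ∀ i, i < k → P (i + 1) * (n - k - i) = P i * (k - i))
    (hRs : ∀ i, i < k → R (i + 1) * (n - d - i) = R i * (d - i)) (i : ℕ) (hi : 1 ≤ i)
    (hik : i ≤ k) : (-1) ^ i * (R i - P i) ≤ (k - d) * w := by
  have hdk' : (d : ℝ) < k := by exact_mod_cast hdk
  have hn' : 2 * (k : ℝ) + 1 ≤ n := by exact_mod_cast (by omega : 2 * k + 1 ≤ n)
  have hP0 : ∀ i, 1 ≤ i → i ≤ k → 0 ≤ P i := by
    intro i hi
    induction i, hi using Nat.le_induction with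
    | base => intro _; rw [hP1]; positivity
    | succ i hi ih =>
      intro hik
      have hik' : (i : ℝ) + 1 ≤ k := by exact_mod_cast hik
      have h1 := hPs i (by omega)
      have h2 := mul_nonneg (ih (by omega)) (by linarith : (0 : ℝ) ≤ k - i)
      rw [← h1] at h2
      exact nonneg_of_mul_nonneg_left h2 (by linarith)
  have hR0 : ∀ i, 1 ≤ i → i ≤ k → 0 ≤ R i := by
    intro i hi
    induction i, hi using Nat.le_induction with
    | base => intro _; rw [hR1]; positivity
    | succ i hi ih =>
      intro hik
      rcases lt_or_ge d (i + 1) with h | h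
      · rw [hR _ h]
      have hik' : (i : ℝ) + 1 ≤ d := by exact_mod_cast h
      have h1 := hRs i (by omega)
      have h2 := mul_nonneg (ih (by omega)) (by linarith : (0 : ℝ) ≤ d - i)
      rw [← h1] at h2
      exact nonneg_of_mul_nonneg_left h2 (by linarith)
  have hRP : ∀ i, 1 ≤ i → i ≤ k → R i ≤ P i := by
    intro i hi
    induction i, hi using Nat.le_induction with
    | base => intro _; rw [hP1, hR1]; gcongr
    | succ i hi ih =>
      intro hik
      rcases lt_or_ge d (i + 1) with h | h
      · rw [hR _ h]; exact hP0 _ (by omega) hik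
      have hik' : (i : ℝ) + 1 ≤ d := by exact_mod_cast h
      have hR' : R (i + 1) = R i * ((d - i) / (n - d - i)) := by
        rw [← mul_div_assoc, ← hRs i (by omega), mul_div_cancel_right₀ _ (by linarith)]
      have hP' : P (i + 1) = P i * ((k - i) / (n - k - i)) := by
        rw [← mul_div_assoc, ← hPs i (by omega), mul_div_cancel_right₀ _ (by linarith)]
      rw [hR', hP']
      refine mul_le_mul (ih (by omega)) ?_ ?_ (hP0 i hi (by omega))
      · apply div_le_div₀ <;> linarith
      · apply div_nonneg <;> linarith
  -- Up to the common factor `n - 2i - 1`, the two sides are the drops `R i - R (i+2)` and `P i - P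
  -- (i+2)`. The case `i = 1` is the polynomial inequality; afterwards the right side shrinks by the
  -- larger ratio.
  have hZ : ∀ i, 1 ≤ i → i + 1 ≤ k →
      R i * (n - 2 * d) / ((n - d - i) * (n - d - i - 1))
        ≤ P i * (n - 2 * k) / ((n - k - i) * (n - k - i - 1)) := by
    intro i hi
    induction i, hi using Nat.le_induction with
    | base =>
      intro hik
      have hd' : (2 : ℝ) ≤ d := by exact_mod_cast hd
      rw [hP1, hR1, div_le_div_iff₀]
      · have := mul_le_mul_of_nonneg_left (mul_sub_mul_le_of_two_mul_add_le hd hdk hn) hw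
        push_cast
        linarith
      · push_cast; apply mul_pos <;> linarith
      · push_cast; apply mul_pos <;> linarith
    | succ i hi ih =>
      intro hik
      have hik' : (i : ℝ) + 1 + 1 ≤ k := by exact_mod_cast hik
      rcases lt_or_ge d (i + 1) with h | h
      · rw [hR _ h, zero_mul, zero_div]
        have := hP0 (i + 1) (by omega) (by omega)
        push_cast
        apply div_nonneg
        · apply mul_nonneg <;> linarith
        · apply mul_nonneg <;> linarith
      have hid : (i : ℝ) + 1 ≤ d := by exact_mod_cast h
      have a1 : (n : ℝ) - d - i ≠ 0 := by linarith
      have a2 : (n : ℝ) - d - i - 1 ≠ 0 := by linarith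
      have a3 : (n : ℝ) - d - i - 2 ≠ 0 := by linarith
      have b1 : (n : ℝ) - k - i ≠ 0 := by linarith
      have b2 : (n : ℝ) - k - i - 1 ≠ 0 := by linarith
      have b3 : (n : ℝ) - k - i - 2 ≠ 0 := by linarith
      have hR' : R (i + 1) = R i * ((d - i) / (n - d - i)) := by
        rw [← mul_div_assoc, ← hRs i (by omega), mul_div_cancel_right₀ _ a1]
      have hP' : P (i + 1) = P i * ((k - i) / (n - k - i)) := by
        rw [← mul_div_assoc, ← hPs i (by omega), mul_div_cancel_right₀ _ b1]
      have eR : R (i + 1) * (n - 2 * d) / ((n - d - (i + 1 : ℕ)) * (n - d - (i + 1 : ℕ) - 1))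
          = R i * (n - 2 * d) / ((n - d - i) * (n - d - i - 1)) * ((d - i) / (n - d - i - 2)) := by
        rw [hR', show (n : ℝ) - d - (i + 1 : ℕ) = n - d - i - 1 by push_cast; ring,
          show (n : ℝ) - d - i - 1 - 1 = n - d - i - 2 by ring]
        field_simp
      have eP : P (i + 1) * (n - 2 * k) / ((n - k - (i + 1 : ℕ)) * (n - k - (i + 1 : ℕ) - 1))
          = P i * (n - 2 * k) / ((n - k - i) * (n - k - i - 1)) * ((k - i) / (n - k - i - 2)) := by
        rw [hP', show (n : ℝ) - k - (i + 1 : ℕ) = n - k - i - 1 by push_cast; ring,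
          show (n : ℝ) - k - i - 1 - 1 = n - k - i - 2 by ring]
        field_simp
      rw [eR, eP]
      refine mul_le_mul (ih (by omega)) ?_ ?_ ?_
      · apply div_le_div₀ <;> linarith
      · apply div_nonneg <;> linarith
      · have := hP0 i hi (by omega)
        apply div_nonneg
        · apply mul_nonneg <;> linarith
        · apply mul_nonneg <;> linarith
  have hstep : ∀ i, 1 ≤ i → i + 2 ≤ k → P (i + 2) - R (i + 2) ≤ P i - R i := by
    intro i hi hik
    have hik' : (i : ℝ) + 2 ≤ k := by exact_mod_cast hik
    have a1 : (n : ℝ) - d - i ≠ 0 := by linarith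
    have a2 : (n : ℝ) - d - i - 1 ≠ 0 := by linarith
    have b1 : (n : ℝ) - k - i ≠ 0 := by linarith
    have b2 : (n : ℝ) - k - i - 1 ≠ 0 := by linarith
    have r1 := hRs i (by omega)
    have r2 := hRs (i + 1) (by omega)
    have p1 := hPs i (by omega)
    have p2 := hPs (i + 1) (by omega)
    push_cast at r2 p2
    have eR : R i - R (i + 2)
        = (n - 2 * i - 1) * (R i * (n - 2 * d) / ((n - d - i) * (n - d - i - 1))) := by
      have : R (i + 2) = R i * (d - i) * (d - i - 1) / ((n - d - i) * (n - d - i - 1)) := by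
        rw [eq_div_iff (mul_ne_zero a1 a2)]
        linear_combination (n - d - i : ℝ) * r2 + (d - i - 1 : ℝ) * r1
      rw [this]
      field_simp
      ring
    have eP : P i - P (i + 2)
        = (n - 2 * i - 1) * (P i * (n - 2 * k) / ((n - k - i) * (n - k - i - 1))) := by
      have : P (i + 2) = P i * (k - i) * (k - i - 1) / ((n - k - i) * (n - k - i - 1)) := by
        rw [eq_div_iff (mul_ne_zero b1 b2)]
        linear_combination (n - k - i : ℝ) * p2 + (k - i - 1 : ℝ) * p1
      rw [this]
      field_simp
      ring
    have := mul_le_mul_of_nonneg_left (hZ i hi (by omega))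
      (by linarith : (0 : ℝ) ≤ n - 2 * i - 1)
    linarith
  have hodd : ∀ j, 2 * j + 1 ≤ k → P (2 * j + 1) - R (2 * j + 1) ≤ (k - d) * w := by
    intro j
    induction j with
    | zero => intro _; simp only [mul_zero, zero_add, hP1, hR1]; linarith
    | succ j ih => intro hj; exact (hstep (2 * j + 1) (by omega) (by omega)).trans (ih (by omega))
  rcases Nat.even_or_odd' i with ⟨j, rfl | rfl⟩
  · rw [Even.neg_one_pow ⟨j, by ring⟩]
    have h1 := hRP (2 * j) hi hik
    have h2 := mul_nonneg (sub_nonneg.2 hdk'.le) hw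
    linarith
  · rw [Odd.neg_one_pow ⟨j, rfl⟩]
    linarith [hodd j hik]

/-- Up to sign, the eigenvalue of the Kneser operator on the `i`-th level. -/
def kneserEigenvalue (n k i : ℕ) : ℝ := (n - k - i).choose (k - i)

/-- Up to sign, the eigenvalue on the `i`-th level of the operator summing the `d`-degrees over
the `d`-element sets disjoint from a given `k`-element set. -/
def degreeEigenvalue (n k d i : ℕ) : ℝ :=
  (n - d - i).choose (n - k - i) * (n - k - i).choose (n - k - d)

theorem kneserEigenvalue_succ {n k i : ℕ} (hn : 2 * k ≤ n) (hi : i < k) :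
    kneserEigenvalue n k (i + 1) * (n - k - i) = kneserEigenvalue n k i * (k - i) := by
  obtain ⟨r, rfl⟩ := Nat.exists_eq_add_of_lt hi
  obtain ⟨s, rfl⟩ := Nat.exists_eq_add_of_le hn
  have h := Nat.add_one_mul_choose_eq (r + s) r
  unfold kneserEigenvalue
  rw [show 2 * (i + r + 1) + s - (i + r + 1) - (i + 1) = r + s by omega,
    show i + r + 1 - (i + 1) = r by omega,
    show 2 * (i + r + 1) + s - (i + r + 1) - i = r + s + 1 by omega,
    show i + r + 1 - i = r + 1 by omega]
  have h' : ((r + s : ℝ) + 1) * (r + s).choose r = (r + s + 1).choose (r + 1) * (r + 1) := by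
    exact_mod_cast h
  push_cast
  linear_combination h'

/-- The lower index `n - k - d` makes the coefficient vanish here; the symmetric index `d - i` would
truncate to 0 and give 1. -/
theorem degreeEigenvalue_eq_zero {n k d i : ℕ} (hn : k + d < n) (hi : d < i) :
    degreeEigenvalue n k d i = 0 := by
  unfold degreeEigenvalue
  rw [Nat.choose_eq_zero_of_lt (by omega : n - k - i < n - k - d)]
  simp

/-- For `i < d` the two binomials scale by `(n-k-i)/(n-d-i)` and `(d-i)/(n-k-i)`, and `n-k-i`
cancels. For `i ≥ d` both sides are zero. -/
theorem degreeEigenvalue_succ {n k d i : ℕ} (hn : 2 * k ≤ n) (hd : d < k) (hi : i < k) :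
    degreeEigenvalue n k d (i + 1) * (n - d - i) = degreeEigenvalue n k d i * (d - i) := by
  rcases lt_trichotomy i d with h | rfl | h
  · obtain ⟨N, hN⟩ : ∃ N, n - d - i = N + 1 := Nat.exists_eq_succ_of_ne_zero (by omega)
    obtain ⟨M, hM⟩ : ∃ M, n - k - i = M + 1 := Nat.exists_eq_succ_of_ne_zero (by omega)
    have h1 := Nat.add_one_mul_choose_eq N M
    have h2 := Nat.choose_mul_succ_eq M (n - k - d)
    rw [show M + 1 - (n - k - d) = d - i by omega] at h2
    have h1' : ((N : ℝ) + 1) * N.choose M = (N + 1).choose (M + 1) * (M + 1) := by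
      exact_mod_cast h1
    have h2' : (M.choose (n - k - d) : ℝ) * (M + 1) = (M + 1).choose (n - k - d) * (d - i) := by
      rw [← Nat.cast_sub h.le]
      exact_mod_cast h2
    have hN' : (n : ℝ) - d - i = N + 1 := by
      have : n = N + 1 + i + d := by omega
      rw [this]; push_cast; ring
    unfold degreeEigenvalue
    rw [hN', hN, hM, show n - d - (i + 1) = N by omega, show n - k - (i + 1) = M by omega]
    linear_combination (M.choose (n - k - d) : ℝ) * h1' + ((N + 1).choose (M + 1) : ℝ) * h2'
  · rw [degreeEigenvalue_eq_zero (by omega) (Nat.lt_succ_self i)]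
    simp
  · rw [degreeEigenvalue_eq_zero (by omega) (by omega), degreeEigenvalue_eq_zero (by omega) h]
    simp

end Spectrum

/-! ### Spectral bound for `Ω - cK` -/

section DegreeBound

open Finset

variable {α : Type*} [Fintype α] [DecidableEq α]

/-- Superset sums and iterated level sums only rescale a level; passing to `Tᶜ` contributes the sign
`(-1) ^ i`. -/
theorem IsHarmonic.degreeKneser_levelSum {i k d : ℕ} {h : Finset α → ℝ} (hh : IsHarmonic i h)
    (hik : i ≤ k) (hdk : d ≤ k) (hn : 2 * k ≤ Fintype.card α) (c : ℝ) {T : Finset α}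
    (hT : T.card = k) :
    degreeKneser k d c (levelSum i h) T
      = (-1) ^ i * (degreeEigenvalue (Fintype.card α) k d i
          - c * kneserEigenvalue (Fintype.card α) k i) * levelSum i h T := by
  have hTc : Tᶜ.card = Fintype.card α - k := by rw [card_compl, hT]
  have hK : levelSum k (levelSum i h) Tᶜ
      = (-1) ^ i * kneserEigenvalue (Fintype.card α) k i * levelSum i h T := by
    rw [levelSum_levelSum hik, hh.levelSum_compl, hTc, kneserEigenvalue]
    ring
  have hD : levelSum d (supersetSum k (levelSum i h)) Tᶜ
      = ((Fintype.card α - d - i).choose (Fintype.card α - k - i) : ℝ)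
        * levelSum d (levelSum i h) Tᶜ := by
    rw [levelSum, levelSum, Finset.mul_sum]
    refine Finset.sum_congr rfl fun S hS => ?_
    rw [hh.supersetSum_levelSum (by omega), (mem_powersetCard.1 hS).2]
  rw [degreeKneser, hK, hD]
  rcases lt_or_ge d i with hdi | hid
  · have h0 : levelSum d (levelSum i h) Tᶜ = 0 := by
      refine Finset.sum_eq_zero fun S hS => ?_
      rw [levelSum, powersetCard_eq_empty.2 (by rw [(mem_powersetCard.1 hS).2]; exact hdi),
        sum_empty]
    rw [h0, degreeEigenvalue_eq_zero (by omega) hdi]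
    ring
  · rw [levelSum_levelSum hid, hh.levelSum_compl, hTc, degreeEigenvalue,
      ← Nat.choose_symm_of_eq_add
        (show Fintype.card α - k - i = (Fintype.card α - k - d) + (d - i) by omega)]
    ring

theorem degreeKneser_sum {ι : Type*} (s : Finset ι) (k d : ℕ) (c : ℝ)
    (u : ι → Finset α → ℝ) (T : Finset α) :
    degreeKneser k d c (fun R => ∑ i ∈ s, u i R) T = ∑ i ∈ s, degreeKneser k d c (u i) T := by
  have h1 : ∀ (j : ℕ) (v : ι → Finset α → ℝ) (A : Finset α),
      levelSum j (fun R => ∑ i ∈ s, v i R) A = ∑ i ∈ s, levelSum j (v i) A :=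
    fun j v A => Finset.sum_comm
  have h2 : supersetSum k (fun R => ∑ i ∈ s, u i R)
      = fun S => ∑ i ∈ s, supersetSum k (u i) S := funext fun S => Finset.sum_comm
  simp only [degreeKneser]
  rw [h1, h2, h1, Finset.sum_sub_distrib, Finset.mul_sum]

theorem degreeKneser_congr {k d : ℕ} {c : ℝ} {f g : Finset α → ℝ}
    (hfg : ∀ T : Finset α, T.card = k → f T = g T) (T : Finset α) :
    degreeKneser k d c f T = degreeKneser k d c g T := by
  have h1 : supersetSum k f = supersetSum k g := funext fun S =>
    Finset.sum_congr rfl fun R hR => hfg R (mem_powersetCard.1 (mem_filter.1 hR).1).2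
  have h2 : ∀ A, levelSum k f A = levelSum k g A := fun A =>
    Finset.sum_congr rfl fun R hR => hfg R (mem_powersetCard.1 hR).2
  rw [degreeKneser, degreeKneser, h1, h2]

/-- A bound on the eigenvalues of `degreeKneser` bounds its quadratic form. -/
theorem sum_mul_degreeKneser_le {k d : ℕ} (hdk : d ≤ k) (hn : 2 * k ≤ Fintype.card α) {c τ : ℝ}
    (hτ : ∀ i ≤ k, (-1) ^ i * (degreeEigenvalue (Fintype.card α) k d i
      - c * kneserEigenvalue (Fintype.card α) k i) ≤ τ) (f : Finset α → ℝ) :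
    ∑ T ∈ (univ : Finset α).powersetCard k, f T * degreeKneser k d c f T
      ≤ τ * ∑ T ∈ (univ : Finset α).powersetCard k, f T ^ 2 := by
  obtain ⟨h, hh, hf⟩ := exists_harmonic_decomposition k f
  set e : ℕ → ℝ := fun i => (-1) ^ i * (degreeEigenvalue (Fintype.card α) k d i
      - c * kneserEigenvalue (Fintype.card α) k i) with he
  have horth : ∀ i ∈ range (k + 1), ∀ j ∈ range (k + 1), j ≠ i →
      ∑ T ∈ (univ : Finset α).powersetCard k, levelSum i (h i) T * levelSum j (h j) T = 0 := by
    intro i hi j hj hij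
    have hi' := Finset.mem_range.1 hi
    have hj' := Finset.mem_range.1 hj
    rcases lt_or_gt_of_ne hij with hlt | hlt
    · simp_rw [mul_comm (levelSum i (h i) _)]
      exact sum_levelSum_mul_levelSum_of_lt hlt (hh i) (by omega)
    · exact sum_levelSum_mul_levelSum_of_lt hlt (hh j) (by omega)
  have hquad : ∀ t : ℕ → ℝ, ∑ T ∈ (univ : Finset α).powersetCard k,
      f T * ∑ j ∈ range (k + 1), t j * levelSum j (h j) T
      = ∑ i ∈ range (k + 1), t i *
        ∑ T ∈ (univ : Finset α).powersetCard k, levelSum i (h i) T ^ 2 := by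
    intro t
    have e1 : ∀ T ∈ (univ : Finset α).powersetCard k,
        f T * ∑ j ∈ range (k + 1), t j * levelSum j (h j) T
        = ∑ i ∈ range (k + 1), ∑ j ∈ range (k + 1),
            t j * (levelSum i (h i) T * levelSum j (h j) T) := by
      intro T hT
      rw [hf T (mem_powersetCard.1 hT).2, Finset.sum_mul_sum]
      exact Finset.sum_congr rfl fun i _ => Finset.sum_congr rfl fun j _ => by ring
    rw [Finset.sum_congr rfl e1, Finset.sum_comm]
    refine Finset.sum_congr rfl fun i hi => ?_
    rw [Finset.sum_comm, Finset.sum_eq_single_of_mem i hi]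
    · rw [Finset.mul_sum]
      exact Finset.sum_congr rfl fun T _ => by ring
    · intro j hj hji
      rw [← Finset.mul_sum, horth i hi j hj hji, mul_zero]
  have hop : ∀ T ∈ (univ : Finset α).powersetCard k, f T * degreeKneser k d c f T
      = f T * ∑ j ∈ range (k + 1), e j * levelSum j (h j) T := by
    intro T hT
    have hT' := (mem_powersetCard.1 hT).2
    rw [degreeKneser_congr hf, degreeKneser_sum]
    congr 1
    exact Finset.sum_congr rfl fun i hi => (hh i).degreeKneser_levelSum
      (Nat.lt_succ_iff.1 (Finset.mem_range.1 hi)) hdk hn c hT'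
  have hsq : ∑ T ∈ (univ : Finset α).powersetCard k, f T ^ 2 = ∑ i ∈ range (k + 1), 1 *
      ∑ T ∈ (univ : Finset α).powersetCard k, levelSum i (h i) T ^ 2 := by
    rw [← hquad fun _ => 1]
    refine Finset.sum_congr rfl fun T hT => ?_
    simp only [one_mul]
    rw [← hf T (mem_powersetCard.1 hT).2, sq]
  rw [Finset.sum_congr rfl hop, hquad, hsq, Finset.mul_sum]
  refine Finset.sum_le_sum fun i hi => ?_
  rw [one_mul]
  exact mul_le_mul_of_nonneg_right (hτ i (Nat.lt_succ_iff.1 (Finset.mem_range.1 hi)))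
    (Finset.sum_nonneg fun T _ => sq_nonneg _)

/-- For a suitable `c`, every eigenvalue of `degreeKneser` is at most the value attained by
the constant functions and by stars. -/
theorem exists_degreeKneser_eigenvalue_le {n k d : ℕ} (hd : 2 ≤ d) (hdk : d < k)
    (hn : 2 * k + 2 * d ≤ n + 3) : ∃ c : ℝ, ∀ i ≤ k,
      (-1) ^ i * (degreeEigenvalue n k d i - c * kneserEigenvalue n k i)
        ≤ (n - d - 1).choose (k - d - 1) * (n - k).choose d := by
  have hdk' : (d : ℝ) < k := by exact_mod_cast hdk
  have hn' : 2 * (k : ℝ) + 1 ≤ n := by exact_mod_cast (by omega : 2 * k + 1 ≤ n)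
  have hnd : (n : ℝ) - d ≠ 0 := by linarith
  have hnk : (n : ℝ) - k ≠ 0 := by linarith
  have ha0 : kneserEigenvalue n k 0 ≠ 0 := by
    simp only [kneserEigenvalue]
    exact_mod_cast (Nat.choose_pos (by omega)).ne'
  set w : ℝ := degreeEigenvalue n k d 0 / (n - d) with hw
  have hb0 : degreeEigenvalue n k d 0 = w * (n - d) := by rw [hw]; field_simp
  have hw0 : 0 ≤ w := by
    apply div_nonneg
    · unfold degreeEigenvalue; positivity
    · linarith
  have hτ : ((k : ℝ) - d) * w = (n - d - 1).choose (k - d - 1) * (n - k).choose d := by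
    have h1 := Nat.add_one_mul_choose_eq (n - d - 1) (k - d - 1)
    rw [show n - d - 1 + 1 = n - d by omega, show k - d - 1 + 1 = k - d by omega] at h1
    have h2 : ((n : ℝ) - d) * (n - d - 1).choose (k - d - 1) = (n - d).choose (k - d) * (k - d) := by
      rw [← Nat.cast_sub hdk.le, ← Nat.cast_sub (by omega : d ≤ n)]
      exact_mod_cast h1
    have h3 : degreeEigenvalue n k d 0 = (n - d).choose (k - d) * (n - k).choose d := by
      simp only [degreeEigenvalue, Nat.sub_zero]
      rw [Nat.choose_symm_of_eq_add (show n - d = (n - k) + (k - d) by omega),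
        Nat.choose_symm (show d ≤ n - k by omega)]
    rw [hw, h3]
    field_simp
    linear_combination (-((n - k).choose d : ℝ)) * h2
  -- This `c` equalizes levels 0 and 1: `w(n-d) - w(n-k)` and `-(dw - kw)` both equal `(k-d)w`.
  refine ⟨w * (n - k) / kneserEigenvalue n k 0, fun i hik => ?_⟩
  rw [← hτ]
  rcases Nat.eq_zero_or_pos i with rfl | hi
  · rw [div_mul_cancel₀ _ ha0, hb0]
    simp only [pow_zero]
    linarith
  refine alternating_sub_le hd hdk hn (R := degreeEigenvalue n k d)
    (P := fun i => w * (n - k) / kneserEigenvalue n k 0 * kneserEigenvalue n k i)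
    hw0 ?_ ?_ ?_ ?_ ?_ i hi hik
  · have := kneserEigenvalue_succ (n := n) (k := k) (i := 0) (by omega) (by omega)
    simp only [zero_add, Nat.cast_zero, sub_zero] at this
    field_simp
    linear_combination w * this
  · have := degreeEigenvalue_succ (n := n) (k := k) (d := d) (i := 0) (by omega) hdk (by omega)
    simp only [zero_add, Nat.cast_zero, sub_zero] at this
    rw [hb0] at this
    apply mul_right_cancel₀ hnd
    linear_combination this
  · exact fun i hi => degreeEigenvalue_eq_zero (by omega) hi
  · intro i hi
    have := kneserEigenvalue_succ (n := n) (k := k) (i := i) (by omega) hi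
    linear_combination w * (n - k) / kneserEigenvalue n k 0 * this
  · intro i hi
    exact degreeEigenvalue_succ (by omega) hdk hi

end DegreeBound

/-! ### The minimum degree bound -/

open Finset in
theorem theorem1 (n k d : ℕ) (hd : 2 ≤ d) (hdk : d < k) (hn : 2 * k + 2 * d - 3 ≤ n)
    (F : Finset (Finset (Fin n))) (hsize : (F : Set (Finset (Fin n))).Sized k)
    (hint : (F : Set (Finset (Fin n))).Intersecting) :
    minDegree d F ≤ Nat.choose (n - d - 1) (k - d - 1) := by
  by_contra! hlt
  have hdeg : ∀ S : Finset (Fin n), S.card = d →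
      (n - d - 1).choose (k - d - 1) + 1 ≤ setDegree F S := fun S hS =>
    hlt.trans_le ((isLeast_minDegree (by omega) F).2 ⟨S, hS, rfl⟩)
  set δ := (n - d - 1).choose (k - d - 1) with hδ
  let f : Finset (Fin n) → ℝ := fun T => if T ∈ F then 1 else 0
  have hF : F ⊆ (univ : Finset (Fin n)).powersetCard k := fun T hT =>
    mem_powersetCard.2 ⟨subset_univ _, hsize hT⟩
  have hsum : ∀ g : Finset (Fin n) → ℝ,
      ∑ T ∈ (univ : Finset (Fin n)).powersetCard k, f T * g T = ∑ T ∈ F, g T := by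
    intro g
    simp only [f, ite_mul, one_mul, zero_mul]
    rw [← Finset.sum_filter, Finset.filter_mem_eq_inter, inter_eq_right.2 hF]
  have hsup : ∀ S, supersetSum k f S = setDegree F S := by
    intro S
    rw [supersetSum, setDegree, Finset.sum_filter]
    have := hsum fun T => if S ⊆ T then 1 else 0
    rw [Finset.card_filter]
    push_cast
    rw [← this]
    exact Finset.sum_congr rfl fun T _ => by simp
  obtain ⟨c, hc⟩ := exists_degreeKneser_eigenvalue_le hd hdk (by omega : 2 * k + 2 * d ≤ n + 3)
  have hmain := sum_mul_degreeKneser_le (α := Fin n) hdk.le (by rw [Fintype.card_fin]; omega)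
    (by rw [Fintype.card_fin]; exact hc) f
  simp_rw [sq] at hmain
  rw [hsum, hsum] at hmain
  have hf1 : ∑ T ∈ F, f T = F.card := by
    rw [Finset.sum_congr rfl fun T hT => if_pos hT]
    simp
  have hlow : ∀ T ∈ F, ((δ : ℝ) + 1) * (n - k).choose d ≤ degreeKneser k d c f T := by
    intro T hT
    -- Intersection enters only here: no member of `F` lies in the complement of another.
    have hK : levelSum k f Tᶜ = 0 := by
      refine Finset.sum_eq_zero fun R hR => if_neg fun hRF => ?_
      exact hint hRF hT (subset_compl_iff_disjoint_right.1 (mem_powersetCard.1 hR).1)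
    rw [degreeKneser, hK, mul_zero, sub_zero, levelSum]
    have hcard : (powersetCard d Tᶜ).card = (n - k).choose d := by
      rw [card_powersetCard, card_compl, hsize hT, Fintype.card_fin]
    rw [← hcard, mul_comm, ← nsmul_eq_mul]
    refine Finset.card_nsmul_le_sum _ _ _ fun S hS => ?_
    rw [hsup]
    exact_mod_cast hdeg S (mem_powersetCard.1 hS).2
  have hlow' := Finset.card_nsmul_le_sum F _ _ hlow
  rw [nsmul_eq_mul] at hlow'
  rw [hf1] at hmain
  -- The excess 1 over `δ` contradicts `hmain` only if `F` is nonempty, which positive degrees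
  -- guarantee.
  have hcard : 0 < F.card := by
    obtain ⟨S, -, hS⟩ := Finset.exists_subset_card_eq
      (s := (univ : Finset (Fin n))) (n := d) (by simp; omega)
    have h1 := hdeg S hS
    have h2 : setDegree F S ≤ F.card := card_filter_le _ _
    omega
  have hpos : (0 : ℝ) < (n - k).choose d * F.card := by
    have : 0 < (n - k).choose d := Nat.choose_pos (by omega)
    positivity
  linarith
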